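/- Let $K$ be an algebraically closed field and let $A$ be a finite-dimensional (associative, unital) $K$-algebra. For $d \ge 0$ let $\operatorname{mod}(A,d)$ be the affine variety of $K$-algebra homomorphisms $M\colon A \to M_d(K)$; a point $M$ is identified with the left $A$-module $K^d$ on which $a \in A$ acts by the matrix $M(a)$. Let $\tau$ be the Auslander–Reiten translation of finite-dimensional left $A$-modules, that is, $\tau(M) = D\operatorname{Tr}(M)$, where $\operatorname{Tr}(M)$ is the cokernel of $\operatorname{Hom}_A(p_1,A)\colon \operatorname{Hom}_A(P_0,A) \to \operatorname{Hom}_A(P_1,A)$ for a minimal projective presentation $P_1 \xrightarrow{p_1} P_0 \to M \to 0$, and $D = \operatorname{Hom}_K(-,K)$. For finite-dimensional left $A$-modules $M,N$ put $E(M,N) := \dim_K \operatorname{Hom}_A(N,\tau(M))$. Then for all $d,d' \ge 0$ the maps $$E(-,?)\colon \operatorname{mod}(A,d)\times\operatorname{mod}(A,d') \to \mathbb{Z},\quad (M,M') \mapsto E(M,M'),$$ $$E(-)\colon \operatorname{mod}(A,d) \to \mathbb{Z},\quad M \mapsto E(M,M)$$ are upper semicontinuous: for each $n \in \mathbb{Z}$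 the sets $\{(M,M') \mid E(M,M') \le n\}$ and $\{M \mid E(M,M) \le n\}$ are Zariski open in the affine varieties $\operatorname{mod}(A,d)\times\operatorname{mod}(A,d')$ and $\operatorname{mod}(A,d)$, respectively. -/

import Mathlib

open scoped Topology

universe u v w

noncomputable section

namespace ModVar

open MulOpposite

/-! ### Zariski topology -/

/-- The Zariski topology on a set `X` of `K`-points that is embedded in an affine space by a
family of coordinate functions `c x i` (`x : X`, `i : σ`): a subset is closed if and only if it is
the set of common zeros of a set (equivalently, an ideal) of polynomials in the coordinates. -/
abbrev zariskiTopology (K : Type u) [Field K] {X : Type v} {σ : Type w} (c : X → σ → K) :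
    TopologicalSpace X :=
  TopologicalSpace.ofClosed
    {Z : Set X | ∃ S : Set (MvPolynomial σ K), Z = {x | ∀ p ∈ S, MvPolynomial.eval (c x) p = 0}}
    ⟨{1}, by ext x; simp⟩
    (by
      intro 𝒵 h𝒵
      refine ⟨{p | ∃ Z ∈ 𝒵, ∀ x ∈ Z, MvPolynomial.eval (c x) p = 0}, ?_⟩
      ext x
      simp only [Set.mem_sInter, Set.mem_ofPred_eq]
      constructor
      · rintro hx p ⟨Z, hZ, hp⟩
        exact hp x (hx Z hZ)
      · intro hx Z hZ
        obtain ⟨S, rfl⟩ := h𝒵 hZ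
        intro p hp
        exact hx p ⟨_, hZ, fun y hy => hy p hp⟩)
    (by
      rintro _ ⟨S, rfl⟩ _ ⟨T, rfl⟩
      refine ⟨{r | ∃ p ∈ S, ∃ q ∈ T, r = p * q}, ?_⟩
      ext x
      simp only [Set.mem_union, Set.mem_ofPred_eq]
      constructor
      · rintro (h | h) _ ⟨p, hp, q, hq, rfl⟩
        · simp [h p hp]
        · simp [h q hq]
      · intro h
        by_contra! hx
        obtain ⟨⟨p, hp, hp0⟩, q, hq, hq0⟩ := hx
        have := h _ ⟨p, hp, q, hq, rfl⟩
        rw [map_mul] at this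
        exact (mul_ne_zero hp0 hq0) this)

/-! ### Varieties of modules -/

section Variety

variable (K : Type u) [Field K] (A : Type v) [Ring A] [Algebra K A]

/-- The variety `mod(A,d)` of `d`-dimensional `A`-modules: its points are the `K`-algebra
homomorphisms `A → M_d(K)`. -/
abbrev ModVariety (d : ℕ) : Type (max u v) := A →ₐ[K] Matrix (Fin d) (Fin d) K

/-- The coordinates on `mod(A,d)`: all matrix entries `M(a)_{ij}`. (They are linear in `a`, so that
the entries for `a` in a `K`-basis of `A` generate the same algebra of functions.) -/
def coord (d : ℕ) (M : ModVariety K A d) : A × Fin d × Fin d → K :=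
  fun t => M t.1 t.2.1 t.2.2

/-- The Zariski topology on `mod(A,d)`. -/
abbrev modTopology (d : ℕ) : TopologicalSpace (ModVariety K A d) :=
  zariskiTopology K (coord K A d)

/-- The Zariski topology on the product variety `mod(A,d) × mod(A,d')`, given by polynomials in the
coordinates of both factors. (It is finer than the product of the two Zariski topologies.) -/
abbrev pairTopology (d d' : ℕ) : TopologicalSpace (ModVariety K A d × ModVariety K A d') :=
  zariskiTopology K (fun p => Sum.elim (coord K A d p.1) (coord K A d' p.2))

end Variety

section Module

variable {K : Type u} [Field K] {A : Type v} [Ring A] [Algebra K A] {d : ℕ}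

/-- The `A`-module given by a point `M` of `mod(A,d)`: the vector space `K^d`, on which `a` acts by
the matrix `M(a)`. -/
def Rep (_M : ModVariety K A d) : Type u := Fin d → K

instance (M : ModVariety K A d) : AddCommGroup (Rep M) :=
  inferInstanceAs (AddCommGroup (Fin d → K))

instance (M : ModVariety K A d) : Module K (Rep M) :=
  inferInstanceAs (Module K (Fin d → K))

instance (M : ModVariety K A d) : FiniteDimensional K (Rep M) :=
  inferInstanceAs (FiniteDimensional K (Fin d → K))

/-- The action of a matrix on `Rep M`. -/
def act (M : ModVariety K A d) (x : Rep M) : Matrix (Fin d) (Fin d) K → Rep M :=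
  fun B => B.mulVec (show Fin d → K from x)

instance (M : ModVariety K A d) : Module A (Rep M) where
  smul a x := act M x (M a)
  one_smul x := (congrArg (act M x) (map_one M)).trans (Matrix.one_mulVec _)
  mul_smul a b x :=
    (congrArg (act M x) (map_mul M a b)).trans (Matrix.mulVec_mulVec _ _ _).symm
  smul_zero a := Matrix.mulVec_zero (M a)
  smul_add a x y := Matrix.mulVec_add (M a) x y
  add_smul a b x := (congrArg (act M x) (map_add M a b)).trans (Matrix.add_mulVec _ _ _)
  zero_smul x := (congrArg (act M x) (map_zero M)).trans (Matrix.zero_mulVec _)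

instance (M : ModVariety K A d) : IsScalarTower K A (Rep M) where
  smul_assoc k a x := (congrArg (act M x) (map_smul M k a)).trans (Matrix.smul_mulVec _ _ _)

instance (M : ModVariety K A d) : Module.Finite A (Rep M) :=
  Module.Finite.of_restrictScalars_finite K A (Rep M)

end Module

/-! ### Projective covers -/

section Cover

variable (A : Type v) [Ring A] (M : Type w) [AddCommGroup M] [Module A M]

/-- A projective cover of `M`: a surjection onto `M` from a finitely generated projective module,
whose kernel is superfluous. -/
structure ProjectiveCover where
  carrier : Type v
  [addCommGroup : AddCommGroup carrier]
  [module : Module A carrier]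
  [finite : Module.Finite A carrier]
  [projective : Module.Projective A carrier]
  π : carrier →ₗ[A] M
  surjective : Function.Surjective π
  superfluous : ∀ N : Submodule A carrier, N ⊔ LinearMap.ker π = ⊤ → N = ⊤

attribute [instance] ProjectiveCover.addCommGroup ProjectiveCover.module
  ProjectiveCover.finite ProjectiveCover.projective

/-- Finitely generated modules over a left Artinian ring have projective covers. -/
theorem nonempty_projectiveCover [IsArtinianRing A] [Module.Finite A M] :
    Nonempty (ProjectiveCover A M) := by
  obtain ⟨n, f, hf⟩ := Module.Finite.exists_fin' A M
  let S : Set (Submodule A (Fin n → A)) :=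
    {Q | Module.Projective A Q ∧ Function.Surjective (f.comp Q.subtype)}
  have hS : S.Nonempty := by
    refine ⟨⊤, ?_, ?_⟩
    · exact Module.Projective.of_equiv (Submodule.topEquiv (R := A) (M := Fin n → A)).symm
    · intro m
      obtain ⟨x, rfl⟩ := hf m
      exact ⟨⟨x, trivial⟩, rfl⟩
  obtain ⟨Q, ⟨hQp, hQs⟩, hmin⟩ := WellFounded.has_min
    (wellFounded_lt (α := Submodule A (Fin n → A))) S hS
  set π := f.comp Q.subtype with hπ
  refine ⟨{ carrier := Q, π := π, surjective := hQs, superfluous := ?_ }⟩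
  intro N hN
  have hNs : Function.Surjective (π.comp N.subtype) := by
    intro m
    obtain ⟨x, rfl⟩ := hQs m
    have hx : x ∈ N ⊔ LinearMap.ker π := hN ▸ Submodule.mem_top
    obtain ⟨y, hy, z, hz, rfl⟩ := Submodule.mem_sup.1 hx
    refine ⟨⟨y, hy⟩, ?_⟩
    simp [LinearMap.mem_ker.1 hz]
  obtain ⟨g, hg⟩ := Module.projective_lifting_property (π.comp N.subtype) π hNs
  let h : Module.End A Q := N.subtype.comp g
  have hh : π.comp h = π := hg
  have hpow : ∀ k : ℕ, π.comp (h ^ k) = π := by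
    intro k
    induction k with
    | zero => rfl
    | succ k ih =>
      rw [pow_succ, Module.End.mul_eq_comp, ← LinearMap.comp_assoc, ih, hh]
  obtain ⟨k, hk, hk1⟩ := ((LinearMap.eventually_isCompl_ker_pow_range_pow h).and
    (Filter.eventually_ge_atTop 1)).exists
  have hRp : Module.Projective A (LinearMap.range (h ^ k)) := by
    refine Module.Projective.of_split (LinearMap.range (h ^ k)).subtype
      (Submodule.projectionOnto (LinearMap.range (h ^ k)) (LinearMap.ker (h ^ k)) hk.symm) ?_
    ext x
    simp
  let R : Submodule A (Fin n → A) := (LinearMap.range (h ^ k)).map Q.subtype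
  have hRS : R ∈ S := by
    refine ⟨Module.Projective.of_equiv
      (Submodule.equivMapOfInjective Q.subtype Q.injective_subtype _), ?_⟩
    intro m
    obtain ⟨x, rfl⟩ := hQs m
    refine ⟨⟨((h ^ k) x : Q), ⟨(h ^ k) x, ⟨x, rfl⟩, rfl⟩⟩, ?_⟩
    exact LinearMap.congr_fun (hpow k) x
  have hRQ : ¬ R < Q := hmin R hRS
  have hle : R ≤ Q := Submodule.map_subtype_le Q _
  have hEq : R = Q := by
    by_contra hne
    exact hRQ (lt_of_le_of_ne hle hne)
  rw [eq_top_iff]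
  rintro x -
  have hx : (x : Fin n → A) ∈ R := by rw [hEq]; exact x.2
  obtain ⟨y, ⟨z, rfl⟩, hy⟩ := hx
  have hyx : (h ^ k) z = x := Subtype.ext hy
  obtain ⟨j, rfl⟩ : ∃ j, k = j + 1 := ⟨k - 1, by omega⟩
  rw [← hyx, pow_succ', Module.End.mul_apply]
  exact (g _).2

/-- A chosen projective cover of a finitely generated module over a left Artinian ring. Projective
covers are unique up to isomorphism. -/
def projectiveCover [IsArtinianRing A] [Module.Finite A M] : ProjectiveCover A M :=
  Classical.choice (nonempty_projectiveCover A M)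

end Cover

/-! ### The Auslander-Reiten translation -/

section Translation

/-- For a linear map `p : P → Q` of left `A`-modules, the map
`Hom_A(p, A) : Hom_A(Q, A) → Hom_A(P, A)` of right `A`-modules. -/
def homA {A : Type v} [Ring A] {P Q : Type v} [AddCommGroup P] [Module A P]
    [AddCommGroup Q] [Module A Q] (p : P →ₗ[A] Q) : (Q →ₗ[A] A) →ₗ[Aᵐᵒᵖ] (P →ₗ[A] A) where
  toFun f := f.comp p
  map_add' _ _ := rfl
  map_smul' _ _ := rfl

section Presentation

variable (A : Type v) [Ring A] [IsArtinianRing A]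
variable (M : Type w) [AddCommGroup M] [Module A M] [Module.Finite A M]

/-- The term `P₀` of the minimal projective presentation `P₁ → P₀ → M → 0`. -/
abbrev P₀ : Type v := (projectiveCover A M).carrier

/-- The kernel of the projective cover `P₀ → M`, the first syzygy of `M`. -/
abbrev Ω : Submodule A (P₀ A M) := LinearMap.ker (projectiveCover A M).π

/-- The term `P₁` of the minimal projective presentation `P₁ → P₀ → M → 0`. -/
abbrev P₁ : Type v := (projectiveCover A (Ω A M)).carrier

/-- The map `P₁ → P₀` of the minimal projective presentation `P₁ → P₀ → M → 0`. -/
def p₁ : P₁ A M →ₗ[A] P₀ A M := (Ω A M).subtype.comp (projectiveCover A (Ω A M)).π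

/-- The transpose `Tr M`, the cokernel of `Hom_A(P₀, A) → Hom_A(P₁, A)`, a right `A`-module. -/
abbrev Tr : Type v := (P₁ A M →ₗ[A] A) ⧸ LinearMap.range (homA (p₁ A M))

end Presentation

/-- The standard duality `D = Hom_K(-, K)` from right to left `A`-modules. -/
def D (K : Type u) [Field K] (X : Type v) [AddCommGroup X] [Module K X] : Type (max u v) :=
  X →ₗ[K] K

section Duality

variable (K : Type u) [Field K] (A : Type v) [Ring A] [Algebra K A]
variable (X : Type v) [AddCommGroup X] [Module K X] [Module Aᵐᵒᵖ X] [IsScalarTower K Aᵐᵒᵖ X]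

instance : AddCommGroup (D K X) := inferInstanceAs (AddCommGroup (X →ₗ[K] K))

instance : Module K (D K X) := inferInstanceAs (Module K (X →ₗ[K] K))

/-- The left `A`-module structure on `D X`, given by `(a φ)(x) = φ(x a)`. -/
instance : Module A (D K X) where
  smul a φ := LinearMap.comp (show X →ₗ[K] K from φ) (Module.toModuleEnd K (S := Aᵐᵒᵖ) X (op a))
  one_smul φ := LinearMap.ext fun x => congrArg (show X →ₗ[K] K from φ) (one_smul Aᵐᵒᵖ x)
  mul_smul a b φ := LinearMap.ext fun x =>
    congrArg (show X →ₗ[K] K from φ) (mul_smul (op b) (op a) x)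
  smul_zero _ := rfl
  smul_add _ _ _ := rfl
  add_smul a b φ := LinearMap.ext fun x =>
    (congrArg (show X →ₗ[K] K from φ) (add_smul (op a) (op b) x)).trans (map_add _ _ _)
  zero_smul φ := LinearMap.ext fun x =>
    (congrArg (show X →ₗ[K] K from φ) (zero_smul Aᵐᵒᵖ x)).trans (map_zero _)

instance : IsScalarTower K A (D K X) where
  smul_assoc k a φ := LinearMap.ext fun x =>
    (congrArg (show X →ₗ[K] K from φ) (smul_assoc k (op a) x)).trans (map_smul _ _ _)

end Duality

variable (K : Type u) [Field K] (A : Type v) [Ring A] [Algebra K A] [IsArtinianRing A]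
variable (M : Type w) [AddCommGroup M] [Module A M] [Module.Finite A M]

/-- The Auslander-Reiten translation `τ M = D Tr M`. -/
abbrev τ : Type (max u v) := D K (Tr A M)

end Translation

/-! ### The `E`-invariant -/

section EInvariant

variable {K : Type u} [Field K] {A : Type v} [Ring A] [Algebra K A] [FiniteDimensional K A]

/-- The `E`-invariant `E(M, N) = dim Hom_A(N, τ M)`. -/
def E {d d' : ℕ} (M : ModVariety K A d) (N : ModVariety K A d') : ℤ :=
  haveI : IsArtinianRing A := IsArtinianRing.of_finite K A
  (Module.finrank K (Rep N →ₗ[A] τ K A (Rep M)) : ℤ)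

end EInvariant

end ModVar

end

/-! For a projective presentation `P₁ → P₀ → M → 0`, `Hom(N, τ M)` is dual to the cokernel of
`Hom(P₀, N) → Hom(P₁, N)`. Counting dimensions gives `E(M, N) = [M, N] - [P₀, N] + [P₁, N]`, where
`[X, N] = dim Hom(X, N)` (`E_add_finrank`). The term `[M, N]` is the dimension of the solution space
of linear equations with regular coefficients, hence semicontinuous (`isOpen_finrank_iInf_ker_le`).
The difficulty is that `P₀` and `P₁` depend on `M`.

The difference `[P₁, N] - [P₀, N]` is additive on short exact sequences in `N`, so two presentations
can be compared on simple modules (`finrank_hom_le_of_simple`). For simple `S` it equals `dim Z(M,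
S) - dim M * dim S`, where `Z(M, S)` is the space of derivations `A → Hom_K(M, S)`
(`finrank_cocycles_presentation`). Here `Z(M, S)` is again given by linear equations with regular
coefficients. There are finitely many simple modules up to isomorphism, so for `M` near `M₀` the
difference for `M` is at most that for `M₀`, on all `N` at once.

It remains to vary `N` with the presentation of `M₀` fixed. The term `[P₁, N]` is semicontinuous,
and so is `-[P₀, N]`, since it differs by a constant from `[Q, N]` for a complement `Q` of `P₀` in a
free module. -/

namespace ModVar

/-! ### Regular functions and semicontinuity of solution spaces -/

section Zariski

variable {K : Type u} [Field K] {X : Type v} {σ : Type w} (c : X → σ → K)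

/-- The algebra of regular functions on `X`: the polynomials in the coordinates. -/
noncomputable def regularFunctions : Subalgebra K (X → K) :=
  (AlgHom.pi (fun x => MvPolynomial.aeval (c x))).range

variable {c}

theorem mem_regularFunctions {f : X → K} :
    f ∈ regularFunctions c ↔ ∃ p : MvPolynomial σ K, ∀ x, f x = MvPolynomial.eval (c x) p := by
  constructor
  · rintro ⟨p, rfl⟩
    exact ⟨p, fun x => by simp [MvPolynomial.aeval_eq_eval]⟩
  · rintro ⟨p, hp⟩
    exact ⟨p, funext fun x => by simp [hp, MvPolynomial.aeval_eq_eval]⟩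

theorem coord_mem_regularFunctions (i : σ) : (fun x => c x i) ∈ regularFunctions c :=
  mem_regularFunctions.2 ⟨MvPolynomial.X i, fun x => by simp⟩

theorem const_mem_regularFunctions (k : K) : (fun _ : X => k) ∈ regularFunctions c :=
  mem_regularFunctions.2 ⟨MvPolynomial.C k, fun x => by simp⟩

theorem isOpen_ne_zero {f : X → K} (hf : f ∈ regularFunctions c) :
    IsOpen[zariskiTopology K c] {x | f x ≠ 0} := by
  obtain ⟨p, hp⟩ := mem_regularFunctions.1 hf
  refine ⟨{p}, ?_⟩
  ext x
  simp [hp]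

theorem det_mem_regularFunctions {n : Type*} [Fintype n] [DecidableEq n] {B : X → Matrix n n K}
    (hB : ∀ i j, (fun x => B x i j) ∈ regularFunctions c) :
    (fun x => (B x).det) ∈ regularFunctions c := by
  have : (fun x => (B x).det) = ∑ s : Equiv.Perm n,
      (Equiv.Perm.sign s : ℤ) • ∏ i, (fun x => B x (s i) i) := by
    ext x
    simp [Matrix.det_apply, Finset.sum_apply, Finset.prod_apply, Units.smul_def]
  rw [this]
  exact sum_mem fun s _ => zsmul_mem (prod_mem fun i _ => hB _ _) _

/-- The dimension of the solution space of a system of linear equations, whose coefficients are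
regular functions, is upper semicontinuous. -/
theorem isOpen_finrank_iInf_ker_le {V : Type*} [AddCommGroup V] [Module K V]
    [FiniteDimensional K V] {ι : Type*} {L : X → ι → Module.Dual K V}
    (hL : ∀ i v, (fun x => L x i v) ∈ regularFunctions c) (m : ℕ) :
    IsOpen[zariskiTopology K c] {x | Module.finrank K (⨅ i, LinearMap.ker (L x i) :
      Submodule K V) ≤ m} := by
  let _ := zariskiTopology K c
  rw [isOpen_iff_forall_mem_open]
  intro x₀ hx₀
  obtain ⟨C, hC⟩ := Submodule.exists_isCompl (⨅ i, LinearMap.ker (L x₀ i))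
  let b := Module.finBasis K C
  -- On a complement of the solution space at `x₀` the equations have no common zero, so their
  -- restrictions span the dual.
  have hspan : Submodule.span K (Set.range fun i => (L x₀ i).comp C.subtype) = ⊤ := by
    have h0 : (Submodule.span K (Set.range fun i => (L x₀ i).comp C.subtype)).dualCoannihilator
        = ⊥ := by
      rw [eq_bot_iff]
      intro v hv
      rw [Submodule.mem_dualCoannihilator] at hv
      have : (v : V) ∈ (⨅ i, LinearMap.ker (L x₀ i)) ⊓ C := by
        refine ⟨?_, v.2⟩
        simp only [Submodule.coe_iInf, Set.mem_iInter, SetLike.mem_coe, LinearMap.mem_ker]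
        exact fun i => hv _ (Submodule.subset_span ⟨i, rfl⟩)
      rw [hC.inf_eq_bot] at this
      simpa using this
    rw [← Subspace.dualCoannihilator_dualAnnihilator_eq (W := Submodule.span K _), h0,
      Submodule.dualAnnihilator_bot]
  have hex : ∀ j, ∃ l : ι →₀ K, l.sum (fun i k => k • (L x₀ i).comp C.subtype) = b.coord j := by
    intro j
    have : b.coord j ∈ Submodule.span K (Set.range fun i => (L x₀ i).comp C.subtype) := by
      rw [hspan]; trivial
    exact Finsupp.mem_span_range_iff_exists_finsupp.1 this
  choose l hl using hex
  -- The combinations `l` that yield the coordinate forms at `x₀` are kept fixed as `x` varies. Thus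
  -- `B x₀ = 1`, and where `det (B x) ≠ 0` the solution space still meets `C` trivially, so its
  -- dimension is at most the codimension of `C`.
  let B : X → Matrix (Fin (Module.finrank K C)) (Fin (Module.finrank K C)) K :=
    fun x => Matrix.of fun j k => (l j).sum fun i t => t * L x i (b k)
  have hB : ∀ j k, (fun x => B x j k) ∈ regularFunctions c := by
    intro j k
    have : (fun x => B x j k) = ∑ i ∈ (l j).support, l j i • fun x => L x i (b k) := by
      ext x
      simp [B, Finsupp.sum]
    rw [this]
    exact sum_mem fun i _ => Subalgebra.smul_mem _ (hL _ _) _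
  refine ⟨_, ?_, isOpen_ne_zero (det_mem_regularFunctions hB), ?_⟩
  · intro x hx
    have hdis : Disjoint (⨅ i, LinearMap.ker (L x i)) C := by
      rw [Submodule.disjoint_def]
      intro v hv hvC
      simp only [Submodule.mem_iInf, LinearMap.mem_ker] at hv
      have hmul : (B x).mulVec (b.repr ⟨v, hvC⟩) = 0 := by
        ext j
        have h1 : ∀ i, ∑ k, L x i (b k) * b.repr ⟨v, hvC⟩ k = 0 := by
          intro i
          have := congrArg (fun w : C => L x i w) (b.sum_repr ⟨v, hvC⟩)
          simp only [hv i, Submodule.coe_sum, map_sum, Submodule.coe_smul, map_smul,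
            smul_eq_mul] at this
          rw [← this]
          exact Finset.sum_congr rfl fun k _ => mul_comm _ _
        simp only [Matrix.mulVec, dotProduct, B, Matrix.of_apply, Finsupp.sum, Finset.sum_mul,
          Pi.zero_apply]
        rw [Finset.sum_comm]
        refine Finset.sum_eq_zero fun i _ => ?_
        simp only [mul_assoc]
        rw [← Finset.mul_sum, h1, mul_zero]
      have h0 := Matrix.eq_zero_of_mulVec_eq_zero hx hmul
      have : (⟨v, hvC⟩ : C) = 0 := by
        apply b.repr.injective
        ext k
        simpa using congrFun h0 k
      simpa using this
    have h1 := Submodule.finrank_add_finrank_le_of_disjoint hdis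
    have h2 := Submodule.finrank_add_eq_of_isCompl hC
    simp only [Set.mem_ofPred_eq] at hx₀ ⊢
    omega
  · have : B x₀ = 1 := by
      ext j k
      have := LinearMap.congr_fun (hl j) (b k)
      simp only [Finsupp.sum, LinearMap.sum_apply] at this
      simpa [B, Finsupp.sum, Matrix.one_apply, Finsupp.single_apply, eq_comm] using this
    simp [this]

end Zariski

open MulOpposite

/-! ### Dimensions of spaces of homomorphisms -/

section Hom

variable {K : Type u} [Field K] {A : Type v} [Ring A] [Algebra K A]
variable {P Q : Type*} [AddCommGroup P] [Module A P] [AddCommGroup Q] [Module A Q]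
variable {N : Type*} [AddCommGroup N] [Module K N] [Module A N] [IsScalarTower K A N]

variable (K N) in
/-- Precomposition with an `A`-linear map, as a `K`-linear map. -/
def precomp (p : P →ₗ[A] Q) : (Q →ₗ[A] N) →ₗ[K] (P →ₗ[A] N) where
  toFun f := f.comp p
  map_add' _ _ := rfl
  map_smul' _ _ := rfl

@[simp]
theorem precomp_apply (p : P →ₗ[A] Q) (f : Q →ₗ[A] N) : precomp K N p f = f.comp p := rfl

theorem precomp_injective {p : P →ₗ[A] Q} (hp : Function.Surjective p) :
    Function.Injective (precomp K N p) := by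
  intro f g h
  ext q
  obtain ⟨x, rfl⟩ := hp q
  exact LinearMap.congr_fun h x

variable (K P) in
/-- Postcomposition with an `A`-linear map, as a `K`-linear map. -/
def postcomp {N' : Type*} [AddCommGroup N'] [Module K N'] [Module A N'] [IsScalarTower K A N']
    (g : N →ₗ[A] N') : (P →ₗ[A] N) →ₗ[K] (P →ₗ[A] N') where
  toFun f := g.comp f
  map_add' f f' := LinearMap.comp_add f f' g
  map_smul' k f := LinearMap.ext fun x => g.map_smul_of_tower k (f x)

theorem finiteDimensional_hom [Module.Finite A P] [FiniteDimensional K N] :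
    FiniteDimensional K (P →ₗ[A] N) := by
  obtain ⟨n, f, hf⟩ := Module.Finite.exists_fin' A P
  let g : (P →ₗ[A] N) →ₗ[K] (Fin n → N) :=
    { toFun := fun h i => h (f (Pi.single i 1))
      map_add' := fun _ _ => rfl
      map_smul' := fun _ _ => rfl }
  refine Module.Finite.of_injective g fun h h' hh => ?_
  have : h.comp f = h'.comp f := LinearMap.pi_ext' fun i => LinearMap.ext_ring (congrFun hh i)
  ext x
  obtain ⟨y, rfl⟩ := hf x
  exact LinearMap.congr_fun this y

theorem finrank_hom_congr_right {N' : Type*} [AddCommGroup N'] [Module K N'] [Module A N']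
    [IsScalarTower K A N'] (e : N ≃ₗ[A] N') :
    Module.finrank K (P →ₗ[A] N) = Module.finrank K (P →ₗ[A] N') := by
  refine LinearEquiv.finrank_eq (LinearEquiv.ofLinearMap (postcomp K P e.toLinearMap)
    (postcomp K P e.symm.toLinearMap) ?_ ?_) <;>
  · ext f x
    simp [postcomp]

theorem finrank_hom_congr_left (e : P ≃ₗ[A] Q) :
    Module.finrank K (P →ₗ[A] N) = Module.finrank K (Q →ₗ[A] N) := by
  refine LinearEquiv.finrank_eq (LinearEquiv.ofLinearMap (precomp K N e.symm.toLinearMap)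
    (precomp K N e.toLinearMap) ?_ ?_) <;>
  · ext f x
    simp

/-- `Hom(P, -)` is additive on short exact sequences for projective `P`. -/
theorem finrank_hom_eq_add_quotient [Module.Finite A P] [Module.Projective A P]
    [FiniteDimensional K N] (N' : Submodule A N) :
    Module.finrank K (P →ₗ[A] N) =
      Module.finrank K (P →ₗ[A] N') + Module.finrank K (P →ₗ[A] N ⧸ N') := by
  have := finiteDimensional_hom (K := K) (A := A) (P := P) (N := N)
  have hinj : Function.Injective (postcomp K P N'.subtype) := by
    intro f g h
    ext x
    exact LinearMap.congr_fun h x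
  have hsurj : Function.Surjective (postcomp K P N'.mkQ) := fun f =>
    Module.projective_lifting_property N'.mkQ f N'.mkQ_surjective
  have hker : LinearMap.ker (postcomp K P N'.mkQ) = LinearMap.range (postcomp K P N'.subtype) := by
    ext f
    rw [LinearMap.mem_ker, LinearMap.mem_range]
    constructor
    · intro hf
      refine ⟨f.codRestrict N' fun x => ?_, LinearMap.ext fun x => rfl⟩
      exact (Submodule.Quotient.mk_eq_zero N').1 (LinearMap.congr_fun hf x)
    · rintro ⟨g, rfl⟩
      ext x
      simp [postcomp]
  have h := LinearMap.finrank_range_add_finrank_ker (postcomp K P N'.mkQ)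
  rw [hker, LinearMap.finrank_range_of_inj hinj, LinearMap.range_eq_top.2 hsurj, finrank_top] at h
  omega

theorem finrank_hom_prod [Module.Finite A P] [Module.Finite A Q] [FiniteDimensional K N] :
    Module.finrank K (P × Q →ₗ[A] N) =
      Module.finrank K (P →ₗ[A] N) + Module.finrank K (Q →ₗ[A] N) := by
  have := finiteDimensional_hom (K := K) (A := A) (P := P) (N := N)
  have := finiteDimensional_hom (K := K) (A := A) (P := Q) (N := N)
  rw [← LinearEquiv.finrank_eq (LinearMap.coprodEquiv (R := A) (M := P) (M₂ := Q) (M₃ := N) K),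
    Module.finrank_prod]

theorem finrank_hom_fin [FiniteDimensional K N] (k : ℕ) :
    Module.finrank K ((Fin k → A) →ₗ[A] N) = k * Module.finrank K N := by
  rw [LinearEquiv.finrank_eq (LinearEquiv.piRing A N (Fin k) K), Module.finrank_pi_fintype]
  simp

end Hom

/-! ### Homomorphisms into the dual of the transpose -/

section Transpose

variable {K : Type u} [Field K] {A : Type v} [Ring A] [Algebra K A]
variable {P Q : Type v} [AddCommGroup P] [Module A P] [AddCommGroup Q] [Module A Q]
variable {N : Type w} [AddCommGroup N] [Module K N] [Module A N] [IsScalarTower K A N]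

theorem exists_dual_basis (A : Type v) [Ring A] (P : Type*) [AddCommGroup P] [Module A P]
    [Module.Finite A P] [Module.Projective A P] :
    ∃ (n : ℕ) (x : Fin n → P) (f : Fin n → P →ₗ[A] A), ∀ p, ∑ i, f i p • x i = p := by
  obtain ⟨n, q, hq⟩ := Module.Finite.exists_fin' A P
  obtain ⟨s, hs⟩ := Module.projective_lifting_property q LinearMap.id hq
  refine ⟨n, fun i => q (Pi.single i 1), fun i => (LinearMap.proj i).comp s, fun p => ?_⟩
  have h := LinearMap.congr_fun hs p
  simp only [LinearMap.comp_apply, LinearMap.id_apply] at h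
  have hx : s p = ∑ i, s p i • Pi.single i (1 : A) := by
    ext j
    simp [Pi.single_apply]
  conv_rhs => rw [← h, hx, map_sum]
  exact Finset.sum_congr rfl fun i _ => (map_smul q _ _).symm

/-- The map `p ↦ f(p) n`, for a linear form `f` on `P` and `n : N`. -/
abbrev formSMul (f : P →ₗ[A] A) (n : N) : P →ₗ[A] N := (LinearMap.toSpanSingleton A N n).comp f

/-- A linear form on `Hom(P, N)` induces linear forms on `Hom(P, A)`. -/
def evalForm (ψ : Module.Dual K (P →ₗ[A] N)) (n : N) : (P →ₗ[A] A) →ₗ[K] K where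
  toFun f := ψ (formSMul f n)
  map_add' f g := by
    rw [← map_add]; congr 1; ext x; simp [add_smul]
  map_smul' k f := by
    rw [RingHom.id_apply, ← map_smul]; congr 1; ext x; simp

/-- The elements of `D X` as linear forms. -/
def toForm (K : Type u) [Field K] (X : Type v) [AddCommGroup X] [Module K X] :
    D K X ≃ₗ[K] (X →ₗ[K] K) := LinearEquiv.refl K _

theorem toForm_smul {X : Type v} [AddCommGroup X] [Module K X] [Module Aᵐᵒᵖ X]
    [IsScalarTower K Aᵐᵒᵖ X] (a : A) (φ : D K X) (x : X) :
    toForm K X (a • φ) x = toForm K X φ (op a • x) := rfl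

theorem D_coker_ext {p : P →ₗ[A] Q} {φ ψ : D K ((P →ₗ[A] A) ⧸ LinearMap.range (homA p))}
    (h : ∀ f, toForm K _ φ (Submodule.Quotient.mk f) = toForm K _ ψ (Submodule.Quotient.mk f)) :
    φ = ψ := by
  refine (toForm K _).injective (LinearMap.ext fun x => ?_)
  obtain ⟨f, rfl⟩ := Submodule.Quotient.mk_surjective _ x
  exact h f

/-- A linear form on `Hom(P, N)` that vanishes on the maps that factor through `p : P → Q` induces
linear forms on the cokernel of `Hom(Q, A) → Hom(P, A)`. -/
def cokerForm (p : P →ₗ[A] Q) (ψ : Module.Dual K (P →ₗ[A] N))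
    (hψ : ψ ∈ (LinearMap.range (precomp K N p)).dualAnnihilator) (n : N) :
    D K ((P →ₗ[A] A) ⧸ LinearMap.range (homA p)) :=
  (toForm K _).symm
  ((Submodule.liftQ ((LinearMap.range (homA p)).restrictScalars K) (evalForm ψ n) (by
    rintro _ ⟨g, rfl⟩
    exact (Submodule.mem_dualAnnihilator _).1 hψ _ ⟨formSMul g n, rfl⟩)).comp
    (Submodule.Quotient.restrictScalarsEquiv K (LinearMap.range (homA p))).symm.toLinearMap)

theorem cokerForm_mk (p : P →ₗ[A] Q) (ψ : Module.Dual K (P →ₗ[A] N))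
    (hψ : ψ ∈ (LinearMap.range (precomp K N p)).dualAnnihilator)
    (n : N) (f : P →ₗ[A] A) :
    toForm K _ (cokerForm p ψ hψ n) (Submodule.Quotient.mk f) = ψ (formSMul f n) := rfl

/-- The `A`-linear map `N → D X` induced by a linear form on the cokernel of
`Hom(Q, N) → Hom(P, N)`, where `X` is the cokernel of `Hom(Q, A) → Hom(P, A)`. -/
def cokerHom (p : P →ₗ[A] Q) (ψ : Module.Dual K (P →ₗ[A] N))
    (hψ : ψ ∈ (LinearMap.range (precomp K N p)).dualAnnihilator) :
    N →ₗ[A] D K ((P →ₗ[A] A) ⧸ LinearMap.range (homA p)) where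
  toFun n := cokerForm p ψ hψ n
  map_add' n n' := D_coker_ext fun f => by
    rw [map_add, LinearMap.add_apply, cokerForm_mk, cokerForm_mk, cokerForm_mk, ← map_add]
    congr 1; ext x; simp
  map_smul' a n := D_coker_ext fun f => by
    rw [RingHom.id_apply, toForm_smul, ← Submodule.Quotient.mk_smul, cokerForm_mk, cokerForm_mk]
    congr 1; ext x; simp [mul_smul]

theorem toForm_cokerHom_mk (p : P →ₗ[A] Q) (ψ : Module.Dual K (P →ₗ[A] N))
    (hψ : ψ ∈ (LinearMap.range (precomp K N p)).dualAnnihilator)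
    (n : N) (f : P →ₗ[A] A) :
    toForm K _ (cokerHom p ψ hψ n) (Submodule.Quotient.mk f) = ψ (formSMul f n) := rfl

/-- `cokerHom` as a linear map on the linear forms on the cokernel of `Hom(Q, N) → Hom(P, N)`. -/
def homDOfForm (p : P →ₗ[A] Q) : (LinearMap.range (precomp K N p)).dualAnnihilator →ₗ[K]
    (N →ₗ[A] D K ((P →ₗ[A] A) ⧸ LinearMap.range (homA p))) where
  toFun ψ := cokerHom p ψ.1 ψ.2
  map_add' ψ ψ' := LinearMap.ext fun n => D_coker_ext fun f => by
    rw [LinearMap.add_apply, map_add, LinearMap.add_apply]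
    simp only [toForm_cokerHom_mk]
    rfl
  map_smul' k ψ := LinearMap.ext fun n => D_coker_ext fun f => by
    rw [RingHom.id_apply, LinearMap.smul_apply, map_smul, LinearMap.smul_apply]
    simp only [toForm_cokerHom_mk]
    rfl

theorem toForm_homDOfForm_mk (p : P →ₗ[A] Q)
    (ψ : (LinearMap.range (precomp K N p)).dualAnnihilator) (n : N) (f : P →ₗ[A] A) :
    toForm K _ (homDOfForm p ψ n) (Submodule.Quotient.mk f) = ψ.1 (formSMul f n) := rfl

/-- A dual basis `x i`, `f i` of `P` writes each `g : P → N` as the sum of the maps `f i (-) • g (x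
i)`. A form on `Hom(P, N)` is therefore determined by its values on such rank-one maps, and these
values are what `homDOfForm` records. -/
theorem homDOfForm_bijective [Module.Finite A P] [Module.Projective A P]
    [Module.Finite A Q] [Module.Projective A Q] (p : P →ₗ[A] Q) :
    Function.Bijective (homDOfForm (K := K) (N := N) p) := by
  obtain ⟨k, x, f, hf⟩ := exists_dual_basis A P
  have hg : ∀ g : P →ₗ[A] N, g = ∑ i, formSMul (f i) (g (x i)) := by
    intro g
    ext y
    conv_lhs => rw [← hf y]
    simp
  constructor
  · intro ψ ψ' h
    ext g
    rw [hg g, map_sum, map_sum]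
    refine Finset.sum_congr rfl fun i _ => ?_
    rw [← toForm_homDOfForm_mk, h, toForm_homDOfForm_mk]
  · intro β
    -- The only possible preimage, read off from the dual basis expansion.
    let ψ : Module.Dual K (P →ₗ[A] N) :=
      { toFun := fun g => ∑ i, toForm K _ (β (g (x i))) (Submodule.Quotient.mk (f i))
        map_add' := fun g g' => by simp [Finset.sum_add_distrib]
        map_smul' := fun k g => by
          simp only [LinearMap.smul_apply, LinearMap.map_smul_of_tower, map_smul, smul_eq_mul,
            Finset.mul_sum, RingHom.id_apply] }
    have hψ : ∀ h n, ψ (formSMul h n) = toForm K _ (β n) (Submodule.Quotient.mk h) := by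
      intro h n
      have hh : h = ∑ i, op (h (x i)) • f i := by
        ext y
        conv_lhs => rw [← hf y]
        simp
      have hq : (Submodule.Quotient.mk h : (P →ₗ[A] A) ⧸ LinearMap.range (homA p)) =
          ∑ i, op (h (x i)) • Submodule.Quotient.mk (f i) := by
        conv_lhs => rw [hh, ← Submodule.mkQ_apply, map_sum]
        rfl
      rw [hq, map_sum]
      change ∑ i, toForm K _ (β (h (x i) • n)) (Submodule.Quotient.mk (f i)) = _
      refine Finset.sum_congr rfl fun i _ => ?_
      exact (congrArg (fun z => toForm K _ z (Submodule.Quotient.mk (f i)))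
        (map_smul β (h (x i)) n)).trans (toForm_smul _ _ _)
    have hmem : ψ ∈ (LinearMap.range (precomp K N p)).dualAnnihilator := by
      rw [Submodule.mem_dualAnnihilator]
      rintro _ ⟨g, rfl⟩
      -- A dual basis of `Q` expands a map factoring through `p` into rank-one maps whose forms `e j
      -- ∘ p` vanish in the cokernel.
      obtain ⟨l, y, e, he⟩ := exists_dual_basis A Q
      have : precomp K N p g = ∑ j, formSMul (homA p (e j)) (g (y j)) := by
        ext z
        rw [precomp_apply, LinearMap.comp_apply, ← he (p z)]
        simp [homA]
      rw [this, map_sum]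
      refine Finset.sum_eq_zero fun j _ => ?_
      have h0 : (Submodule.Quotient.mk (homA p (e j)) :
          (P →ₗ[A] A) ⧸ LinearMap.range (homA p)) = 0 :=
        (Submodule.Quotient.mk_eq_zero _).2 (LinearMap.mem_range_self _ _)
      rw [hψ, h0, map_zero]
    exact ⟨⟨ψ, hmem⟩, LinearMap.ext fun n => D_coker_ext fun h => hψ h n⟩

theorem finrank_hom_D_coker [Module.Finite A P] [Module.Projective A P]
    [Module.Finite A Q] [Module.Projective A Q] [FiniteDimensional K N] (p : P →ₗ[A] Q) :
    Module.finrank K (LinearMap.range (precomp K N p)) +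
      Module.finrank K (N →ₗ[A] D K ((P →ₗ[A] A) ⧸ LinearMap.range (homA p))) =
      Module.finrank K (P →ₗ[A] N) := by
  have := finiteDimensional_hom (K := K) (A := A) (P := P) (N := N)
  rw [← LinearEquiv.finrank_eq (LinearEquiv.ofBijective _ (homDOfForm_bijective (K := K) (N := N) p))]
  exact Subspace.finrank_add_finrank_dualAnnihilator_eq _

/-- Left exactness of `Hom(-, N)` on `P → Q → M → 0`, combined with rank-nullity. -/
theorem finrank_range_precomp {M : Type*} [AddCommGroup M] [Module A M] [Module.Finite A Q]
    [FiniteDimensional K N] {p : P →ₗ[A] Q} {π : Q →ₗ[A] M}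
    (hπ : Function.Surjective π) (hp : LinearMap.range p = LinearMap.ker π) :
    Module.finrank K (LinearMap.range (precomp K N p)) + Module.finrank K (M →ₗ[A] N) =
      Module.finrank K (Q →ₗ[A] N) := by
  have := finiteDimensional_hom (K := K) (A := A) (P := Q) (N := N)
  have hker : LinearMap.ker (precomp K N p) = LinearMap.range (precomp K N π) := by
    ext f
    rw [LinearMap.mem_ker, LinearMap.mem_range]
    constructor
    · intro hf
      have hle : LinearMap.ker π ≤ LinearMap.ker f := by
        rw [← hp]
        rintro _ ⟨x, rfl⟩
        exact LinearMap.congr_fun hf x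
      refine ⟨((LinearMap.ker π).liftQ f hle).comp
        (π.quotKerEquivOfSurjective hπ).symm.toLinearMap, LinearMap.ext fun x => ?_⟩
      have : (π.quotKerEquivOfSurjective hπ).symm (π x) = Submodule.Quotient.mk x := by
        rw [LinearEquiv.symm_apply_eq]; rfl
      simp [this]
    · rintro ⟨g, rfl⟩
      ext x
      have : π (p x) = 0 := by
        rw [← LinearMap.mem_ker, ← hp]; exact ⟨x, rfl⟩
      simp [this]
  have h := LinearMap.finrank_range_add_finrank_ker (precomp K N p)
  rwa [hker, LinearMap.finrank_range_of_inj (precomp_injective hπ)] at h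

end Transpose

/-! ### Derivations and the first syzygy -/

section Cocycle

variable {K : Type u} [Field K] {A : Type v} [Ring A] [Algebra K A]

variable (K A) in
/-- The space of derivations `A → Hom_K(M, S)`. -/
def cocycles (M S : Type*) [AddCommGroup M] [Module K M] [Module A M]
    [AddCommGroup S] [Module K S] [Module A S] [IsScalarTower K A S] :
    Submodule K (A →ₗ[K] M →ₗ[K] S) where
  carrier := {δ | ∀ a b m, b • δ a m + δ b (a • m) = δ (b * a) m}
  add_mem' {δ δ'} h h' a b m := by
    simp only [LinearMap.add_apply, smul_add, ← h a b m, ← h' a b m]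
    abel
  zero_mem' a b m := by simp
  smul_mem' k δ h a b m := by
    simp only [LinearMap.smul_apply, ← h a b m, smul_add, smul_comm b k]

variable {P S M : Type*} [AddCommGroup P] [Module K P] [Module A P] [IsScalarTower K A P]
  [AddCommGroup S] [Module K S] [Module A S] [IsScalarTower K A S]
  [AddCommGroup M] [Module K M] [Module A M] [IsScalarTower K A M]

/-- Derivations on a projective module are inner. -/
theorem exists_inner_of_projective [Module.Projective A P] {δ : A →ₗ[K] P →ₗ[K] S}
    (hδ : δ ∈ cocycles K A P S) :
    ∃ T : P →ₗ[K] S, ∀ a p, δ a p = a • T p - T (a • p) := by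
  obtain ⟨s, hs⟩ := Module.projective_def'.1 (inferInstance : Module.Projective A P)
  -- On the free module the value `-δ c x` at the basis element `x` with coefficient `c` works, by
  -- the derivation rule for `a * c`. Restricting along the splitting `s` gives the claim on `P`.
  let T₀ : (P →₀ A) →ₗ[K] S := Finsupp.lsum K fun x => -(δ.flip x)
  have hT₀ : ∀ a f, δ a (Finsupp.linearCombination A id f) = a • T₀ f - T₀ (a • f) := by
    intro a f
    induction f using Finsupp.induction_linear with
    | zero => simp
    | add f g hf hg => rw [map_add, map_add, hf, hg, smul_add, map_add, map_add, smul_add]; abel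
    | single x c =>
      have := hδ c a x
      simp only [Finsupp.linearCombination_single, id_eq, Finsupp.smul_single, smul_eq_mul, T₀,
        Finsupp.lsum_single, LinearMap.neg_apply, LinearMap.flip_apply, smul_neg, ← this]
      abel
  refine ⟨T₀.comp (s.restrictScalars K), fun a p => ?_⟩
  have h := LinearMap.congr_fun hs p
  simp only [LinearMap.comp_apply, LinearMap.id_apply] at h
  conv_lhs => rw [← h]
  rw [hT₀]
  simp

/-- The count comes from an exact sequence `0 → Hom_A(P, S) → Hom_A(ker π, S) × Hom_K(M, S) → Z(M,
S) → 0`, with maps `Ψ` and `Φ` below. It expresses that `P` is projective: every derivation is a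
pushout of the one for `0 → ker π → P → M → 0`, up to an inner one. -/
theorem finrank_cocycles_add [Module.Finite A P] [Module.Projective A P]
    [FiniteDimensional K P] [FiniteDimensional K A] [FiniteDimensional K S]
    [FiniteDimensional K M] {π : P →ₗ[A] M} (hπ : Function.Surjective π) :
    Module.finrank K (cocycles K A M S) + Module.finrank K (P →ₗ[A] S) =
      Module.finrank K (LinearMap.ker π →ₗ[A] S) + Module.finrank K M * Module.finrank K S := by
  have : IsArtinianRing A := IsArtinianRing.of_finite K A
  have := finiteDimensional_hom (K := K) (A := A) (P := LinearMap.ker π) (N := S)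
  obtain ⟨s, hs⟩ := LinearMap.exists_rightInverse_of_surjective (π.restrictScalars K)
    (LinearMap.range_eq_top.2 hπ)
  have hs' : ∀ m, π (s m) = m := fun m => LinearMap.congr_fun hs m
  -- The failure of the `K`-linear section `s` to be `A`-linear, a derivation with values in
  -- `Hom_K(M, ker π)`.
  let κ : A →ₗ[K] M →ₗ[K] LinearMap.ker π :=
    LinearMap.mk₂ K (fun a m => ⟨s (a • m) - a • s m, by simp [hs']⟩)
      (fun a b m => Subtype.ext <| by
        simp only [add_smul, map_add, Submodule.coe_add]; abel)
      (fun k a m => Subtype.ext <| by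
        simp only [smul_assoc, map_smul, Submodule.coe_smul_of_tower, smul_sub])
      (fun a m n => Subtype.ext <| by
        simp only [smul_add, map_add, Submodule.coe_add]; abel)
      (fun k a m => Subtype.ext <| by
        simp only [smul_comm a k, map_smul, Submodule.coe_smul_of_tower, smul_sub])
  have hκ : ∀ a m, (κ a m : P) = s (a • m) - a • s m := fun a m => rfl
  have hκ' : ∀ a b m, κ (b * a) m = b • κ a m + κ b (a • m) := fun a b m => Subtype.ext <| by
    simp only [hκ, Submodule.coe_add, Submodule.coe_smul, smul_sub, mul_smul]; abel
  let Φ : (LinearMap.ker π →ₗ[A] S) × (M →ₗ[K] S) →ₗ[K] cocycles K A M S :=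
    { toFun := fun φt => ⟨LinearMap.mk₂ K
        (fun a m => φt.1 (κ a m) + (a • φt.2 m - φt.2 (a • m)))
        (fun a b m => by simp only [map_add, LinearMap.add_apply, add_smul]; abel)
        (fun k a m => by
          simp only [map_smul, LinearMap.smul_apply, LinearMap.map_smul_of_tower, smul_assoc,
            smul_add, smul_sub])
        (fun a m n => by simp only [map_add, smul_add]; abel)
        (fun k a m => by
          simp only [map_smul, LinearMap.map_smul_of_tower, smul_comm a k, smul_add, smul_sub]),
        fun a b m => by
          simp only [LinearMap.mk₂_apply, hκ', map_add, map_smul, mul_smul, smul_add, smul_sub]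
          abel⟩
      map_add' := fun φ φ' => Subtype.ext <| LinearMap.ext₂ fun a m => by
        simp only [LinearMap.mk₂_apply, Prod.fst_add, Prod.snd_add, LinearMap.add_apply,
          Submodule.coe_add, smul_add]
        abel
      map_smul' := fun k φ => Subtype.ext <| LinearMap.ext₂ fun a m => by
        simp only [LinearMap.mk₂_apply, Prod.smul_fst, Prod.smul_snd, LinearMap.smul_apply,
          Submodule.coe_smul, smul_add, smul_sub, smul_comm a k, RingHom.id_apply] }
  have hΦ : ∀ φ t a m, (Φ (φ, t)).1 a m = φ (κ a m) + (a • t m - t (a • m)) :=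
    fun _ _ _ _ => rfl
  let Ψ : (P →ₗ[A] S) →ₗ[K] (LinearMap.ker π →ₗ[A] S) × (M →ₗ[K] S) :=
    { toFun := fun F => (F.comp (LinearMap.ker π).subtype, (F.restrictScalars K).comp s)
      map_add' := fun _ _ => rfl
      map_smul' := fun _ _ => rfl }
  have hdecomp : ∀ p, p - s (π p) ∈ LinearMap.ker π := fun p => by simp [hs']
  have hΨ : Function.Injective Ψ := by
    intro F G h
    have h1 := congrArg Prod.fst h
    have h2 := congrArg Prod.snd h
    ext p
    have e1 := LinearMap.congr_fun h1 ⟨_, hdecomp p⟩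
    have e2 := LinearMap.congr_fun h2 (π p)
    change F (p - s (π p)) = G (p - s (π p)) at e1
    change F (s (π p)) = G (s (π p)) at e2
    rwa [map_sub, map_sub, e2, sub_left_inj] at e1
  have hΦs : Function.Surjective Φ := by
    rintro ⟨δ, hδ⟩
    -- Pulled back along `π`, the derivation becomes inner on `P`, given by some `T`. It vanishes on
    -- `ker π`, so `T` is `A`-linear there. The preimage is this restriction together with `T ∘ s`.
    obtain ⟨T, hT⟩ := exists_inner_of_projective
      (δ := (LinearMap.lcomp K S (π.restrictScalars K)).comp δ) (P := P) (by
        intro a b p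
        simpa using hδ a b (π p))
    simp only [LinearMap.comp_apply, LinearMap.lcomp_apply, LinearMap.restrictScalars_apply] at hT
    refine ⟨(
      { toFun := fun w => T w
        map_add' := fun _ _ => map_add T _ _
        map_smul' := fun a w => ?_ }, T.comp s), ?_⟩
    · have h := hT a (w : P)
      rw [LinearMap.mem_ker.1 w.2, map_zero] at h
      exact (sub_eq_zero.1 h.symm).symm
    · refine Subtype.ext <| LinearMap.ext₂ fun a m => ?_
      rw [hΦ]
      have h := hT a (s m)
      rw [hs'] at h
      change T (κ a m : P) + (a • T (s m) - T (s (a • m))) = δ a m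
      rw [h, hκ, map_sub]
      abel
  have hker : LinearMap.ker Φ = LinearMap.range Ψ := by
    ext ⟨φ, t⟩
    rw [LinearMap.mem_ker, LinearMap.mem_range]
    constructor
    · intro h
      have h' : ∀ a m, φ (κ a m) + (a • t m - t (a • m)) = 0 := fun a m => by
        rw [← hΦ, h]; rfl
      -- The `K`-linear projection onto `ker π` along the image of `s`. The map `φ ∘ r + t ∘ π`
      -- glues `φ` and `t`, and the vanishing of `Φ (φ, t)` makes it `A`-linear.
      let r : P →ₗ[K] LinearMap.ker π :=
        { toFun := fun p => ⟨_, hdecomp p⟩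
          map_add' := fun p q => Subtype.ext <| by
            simp only [map_add, Submodule.coe_add]; abel
          map_smul' := fun k p => Subtype.ext <| by
            simp [LinearMap.map_smul_of_tower, smul_sub] }
      have hr : ∀ a p, r (a • p) = a • r p - κ a (π p) := fun a p => Subtype.ext <| by
        simp [r, hκ, smul_sub]
      refine ⟨{ toFun := fun p => φ (r p) + t (π p)
                map_add' := fun p q => by simp only [map_add]; abel
                map_smul' := fun a p => ?_ }, ?_⟩
      · have := h' a (π p)
        rw [hr, map_sub, map_smul, map_smul, RingHom.id_apply, smul_add]
        rw [← sub_eq_zero, ← neg_eq_zero, ← this]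
        abel
      · refine Prod.ext (LinearMap.ext fun w => ?_) (LinearMap.ext fun m => ?_)
        · change φ (r w) + t (π w) = φ w
          have : r w = w := Subtype.ext <| by simp [r]
          rw [this, LinearMap.mem_ker.1 w.2, map_zero, add_zero]
        · change φ (r (s m)) + t (π (s m)) = t m
          have : r (s m) = 0 := Subtype.ext <| by simp [r, hs']
          rw [this, hs', map_zero, zero_add]
    · rintro ⟨F, hF⟩
      obtain ⟨rfl, rfl⟩ := Prod.mk.inj hF
      refine Subtype.ext <| LinearMap.ext₂ fun a m => ?_
      rw [hΦ]
      change F (κ a m : P) + (a • F (s m) - F (s (a • m))) = 0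
      rw [hκ, map_sub, F.map_smul]
      abel
  have h := LinearMap.finrank_range_add_finrank_ker (K := K)
    (V := (LinearMap.ker π →ₗ[A] S) × (M →ₗ[K] S)) (V₂ := cocycles K A M S) Φ
  rw [hker, LinearMap.finrank_range_of_inj hΨ, LinearMap.range_eq_top.2 hΦs, finrank_top,
    Module.finrank_prod, Module.finrank_linearMap K K M S] at h
  exact h

end Cocycle

/-! ### Simple modules: projective covers and dévissage -/

section Simple

variable {K : Type u} [Field K] {A : Type v} [Ring A] [Algebra K A]

/-- The image of `ker π` in the simple module `S` is zero or everything. In the second case `ker f +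
ker π` is all of `P`, so `f = 0` by superfluity. -/
theorem ker_le_ker_of_superfluous {P M S : Type*} [AddCommGroup P] [Module A P] [AddCommGroup M]
    [Module A M] [AddCommGroup S] [Module A S] [IsSimpleModule A S] {π : P →ₗ[A] M}
    (hπ : ∀ N : Submodule A P, N ⊔ LinearMap.ker π = ⊤ → N = ⊤) (f : P →ₗ[A] S) :
    LinearMap.ker π ≤ LinearMap.ker f := by
  rcases eq_bot_or_eq_top ((LinearMap.ker π).map f) with h | h
  · exact Submodule.map_le_iff_le_comap.1 h.le
  · have h1 := Submodule.comap_map_eq f (LinearMap.ker π)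
    rw [h, Submodule.comap_top, sup_comm] at h1
    rw [hπ _ h1.symm]
    exact le_top

/-- Maps to a simple module do not change under projective covers. -/
theorem finrank_hom_projectiveCover {M : Type*} [AddCommGroup M] [Module A M]
    (c : ProjectiveCover A M) {S : Type*} [AddCommGroup S] [Module K S] [Module A S]
    [IsScalarTower K A S] [IsSimpleModule A S] :
    Module.finrank K (c.carrier →ₗ[A] S) = Module.finrank K (M →ₗ[A] S) := by
  refine (LinearEquiv.finrank_eq (LinearEquiv.ofBijective (precomp K S c.π)
    ⟨precomp_injective c.surjective, fun f => ?_⟩)).symm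
  refine ⟨((LinearMap.ker c.π).liftQ f (ker_le_ker_of_superfluous c.superfluous f)).comp
        (c.π.quotKerEquivOfSurjective c.surjective).symm.toLinearMap, LinearMap.ext fun x => ?_⟩
  have : (c.π.quotKerEquivOfSurjective c.surjective).symm (c.π x) = Submodule.Quotient.mk x := by
    rw [LinearEquiv.symm_apply_eq]; rfl
  simp [this]

/-- An inequality between dimensions of spaces of homomorphisms from projective modules holds for
all modules if it holds for the simple ones. -/
theorem finrank_hom_le_of_simple {P Q P' Q' : Type*} [AddCommGroup P] [Module A P]
    [AddCommGroup Q] [Module A Q] [AddCommGroup P'] [Module A P'] [AddCommGroup Q'] [Module A Q']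
    [Module.Finite A P] [Module.Projective A P] [Module.Finite A Q] [Module.Projective A Q]
    [Module.Finite A P'] [Module.Projective A P'] [Module.Finite A Q'] [Module.Projective A Q']
    (h : ∀ (S : Type w) [AddCommGroup S] [Module K S] [Module A S] [IsScalarTower K A S]
      [FiniteDimensional K S] [IsSimpleModule A S],
      Module.finrank K (P →ₗ[A] S) + Module.finrank K (Q' →ₗ[A] S) ≤
        Module.finrank K (P' →ₗ[A] S) + Module.finrank K (Q →ₗ[A] S))
    (N : Type w) [AddCommGroup N] [Module K N] [Module A N] [IsScalarTower K A N]
    [FiniteDimensional K N] :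
    Module.finrank K (P →ₗ[A] N) + Module.finrank K (Q' →ₗ[A] N) ≤
      Module.finrank K (P' →ₗ[A] N) + Module.finrank K (Q →ₗ[A] N) := by
  induction hn : Module.finrank K N using Nat.strong_induction_on generalizing N with
  | _ n ih =>
  have : IsNoetherian A N := isNoetherian_of_tower K inferInstance
  rcases subsingleton_or_nontrivial N with hN | hN
  · simp [Module.finrank_zero_of_subsingleton]
  · obtain ⟨N', hN', -⟩ := (IsCoatomic.eq_top_or_exists_le_coatom (⊥ : Submodule A N)).resolve_left
      bot_ne_top
    have : IsSimpleModule A (N ⧸ N') := isSimpleModule_iff_isCoatom.2 hN'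
    have : FiniteDimensional K (N ⧸ N') := Module.Finite.of_surjective
      (N'.mkQ.restrictScalars K) N'.mkQ_surjective
    have : FiniteDimensional K N' :=
      inferInstanceAs (FiniteDimensional K (N'.restrictScalars K))
    have hlt : Module.finrank K N' < Module.finrank K N := by
      have := Submodule.finrank_lt (s := N'.restrictScalars K) (by
        simpa using hN'.1)
      exact this
    have h1 := ih _ (hn ▸ hlt) N' rfl
    have h2 := h (N ⧸ N')
    simp only [finrank_hom_eq_add_quotient (K := K) N']
    omega

end Simple

/-! ### Points of module varieties and the finite list of simple modules -/

section Variety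

variable {K : Type u} [Field K] {A : Type v} [Ring A] [Algebra K A]

/-- Every finite-dimensional module is isomorphic to a point of a variety of modules. -/
theorem exists_rep_linearEquiv (N : Type*) [AddCommGroup N] [Module K N] [Module A N]
    [IsScalarTower K A N] [FiniteDimensional K N] :
    ∃ R : ModVariety K A (Module.finrank K N), Nonempty (Rep R ≃ₗ[A] N) := by
  let b := Module.finBasis K N
  refine ⟨(LinearMap.toMatrixAlgEquiv b).toAlgHom.comp (Algebra.lsmul K K N),
    ⟨LinearEquiv.symm { b.equivFun with map_smul' := fun a x => ?_ }⟩⟩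
  change b.equivFun (a • x) = ((LinearMap.toMatrixAlgEquiv b) (Algebra.lsmul K K N a)).mulVec _
  exact (LinearMap.toMatrix_mulVec_repr b b (Algebra.lsmul K K N a) x).symm

/-- A finite-dimensional module has only finitely many simple quotients of submodules. -/
theorem exists_list_simple (X : Type w) [AddCommGroup X] [Module K X] [Module A X]
    [IsScalarTower K A X] [FiniteDimensional K X] :
    ∃ l : List (Σ s : ℕ, ModVariety K A s), ∀ (S : Type*) [AddCommGroup S] [Module A S]
      [IsSimpleModule A S] (f : X →ₗ[A] S), f ≠ 0 → ∃ t ∈ l, Nonempty (S ≃ₗ[A] Rep t.2) := by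
  induction hn : Module.finrank K X using Nat.strong_induction_on generalizing X with
  | _ n ih =>
  have : IsNoetherian A X := isNoetherian_of_tower K inferInstance
  rcases subsingleton_or_nontrivial X with hX | hX
  · exact ⟨[], fun S _ _ _ f hf => (hf (Subsingleton.elim _ _)).elim⟩
  · obtain ⟨X', hX', -⟩ := (IsCoatomic.eq_top_or_exists_le_coatom (⊥ : Submodule A X)).resolve_left
      bot_ne_top
    have : IsSimpleModule A (X ⧸ X') := isSimpleModule_iff_isCoatom.2 hX'
    have : FiniteDimensional K (X ⧸ X') := Module.Finite.of_surjective
      (X'.mkQ.restrictScalars K) X'.mkQ_surjective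
    have : FiniteDimensional K X' :=
      inferInstanceAs (FiniteDimensional K (X'.restrictScalars K))
    have hlt : Module.finrank K X' < Module.finrank K X := by
      have := Submodule.finrank_lt (s := X'.restrictScalars K) (by
        simpa using hX'.1)
      exact this
    obtain ⟨l, hl⟩ := ih _ (hn ▸ hlt) X' rfl
    obtain ⟨R, ⟨e⟩⟩ := exists_rep_linearEquiv (K := K) (A := A) (X ⧸ X')
    refine ⟨⟨_, R⟩ :: l, fun S _ _ _ f hf => ?_⟩
    -- Either `f` factors through the simple quotient `X ⧸ X'` and identifies it with `S`, or `f` is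
    -- nonzero on `X'` and induction applies.
    by_cases h0 : f.comp X'.subtype = 0
    · have hle : X' ≤ LinearMap.ker f := fun x hx => LinearMap.congr_fun h0 ⟨x, hx⟩
      have hne : X'.liftQ f hle ≠ 0 := by
        rintro h
        apply hf
        rw [← X'.liftQ_mkQ f hle, h, LinearMap.zero_comp]
      exact ⟨_, List.mem_cons_self,
        ⟨(LinearEquiv.ofBijective _ (LinearMap.bijective_of_ne_zero hne)).symm.trans e.symm⟩⟩
    · obtain ⟨t, ht, h⟩ := hl S _ h0
      exact ⟨t, List.mem_cons_of_mem _ ht, h⟩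

end Variety

/-! ### Semicontinuity in regular families -/

section Family

variable {K : Type u} [Field K] {A : Type v} [Ring A] [Algebra K A]
variable {X : Type*} {σ : Type*} {c : X → σ → K} {d d' : ℕ}

variable (c) in
/-- A family of points of `mod(A,d)` all of whose matrix entries are regular functions. -/
def IsRegularFamily (F : X → ModVariety K A d) : Prop :=
  ∀ a i j, (fun x => F x a i j) ∈ regularFunctions c

theorem isRegularFamily_const (M : ModVariety K A d) : IsRegularFamily c fun _ => M :=
  fun _ _ _ => const_mem_regularFunctions _

theorem form_mem_regularFunctions {v : X → Fin d → K}
    (hv : ∀ i, (fun x => v x i) ∈ regularFunctions c) (φ : (Fin d → K) →ₗ[K] K) :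
    (fun x => φ (v x)) ∈ regularFunctions c := by
  have : (fun x => φ (v x)) = ∑ i, φ (fun j => if i = j then 1 else 0) • fun x => v x i := by
    ext x
    rw [LinearMap.pi_apply_eq_sum_univ φ (v x)]
    simp [mul_comm]
  rw [this]
  exact sum_mem fun i _ => Subalgebra.smul_mem _ (hv i) _

theorem IsRegularFamily.mulVec {F : X → ModVariety K A d} (hF : IsRegularFamily c F) (a : A)
    (m : Fin d → K) (i : Fin d) : (fun x => (F x a).mulVec m i) ∈ regularFunctions c := by
  have : (fun x => (F x a).mulVec m i) = ∑ j, m j • fun x => F x a i j := by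
    ext x
    simp [Matrix.mulVec, dotProduct, mul_comm]
  rw [this]
  exact sum_mem fun j _ => Subalgebra.smul_mem _ (hF a i j) _

/-- The underlying space of `Rep M`. -/
def repEquiv (M : ModVariety K A d) : Rep M ≃ₗ[K] (Fin d → K) := LinearEquiv.refl K _

theorem finrank_rep (M : ModVariety K A d) : Module.finrank K (Rep M) = d := by
  rw [(repEquiv M).finrank_eq, Module.finrank_fin_fun]

/-- The linear equations for homomorphisms between points of varieties of modules. -/
def homEquation (M : ModVariety K A d) (N : ModVariety K A d') (t : A × (Fin d → K) × Fin d') :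
    Module.Dual K ((Fin d → K) →ₗ[K] (Fin d' → K)) where
  toFun h := (N t.1).mulVec (h t.2.1) t.2.2 - h ((M t.1).mulVec t.2.1) t.2.2
  map_add' h h' := by simp only [LinearMap.add_apply, Matrix.mulVec_add, Pi.add_apply]; ring
  map_smul' k h := by
    simp only [LinearMap.smul_apply, Matrix.mulVec_smul, Pi.smul_apply, smul_eq_mul,
      RingHom.id_apply]
    ring

theorem finrank_hom_rep (M : ModVariety K A d) (N : ModVariety K A d') :
    Module.finrank K (Rep M →ₗ[A] Rep N) =
      Module.finrank K (⨅ t, LinearMap.ker (homEquation M N t) :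
        Submodule K ((Fin d → K) →ₗ[K] (Fin d' → K))) := by
  let θ : (Rep M →ₗ[A] Rep N) →ₗ[K] (Fin d → K) →ₗ[K] (Fin d' → K) :=
    { toFun := fun f => ((repEquiv N).toLinearMap.comp (f.restrictScalars K)).comp
        (repEquiv M).symm.toLinearMap
      map_add' := fun _ _ => rfl
      map_smul' := fun _ _ => rfl }
  have hθ : Function.Injective θ := fun f g h => LinearMap.ext fun m => LinearMap.congr_fun h m
  rw [← LinearMap.finrank_range_of_inj hθ]
  suffices hr : LinearMap.range θ = ⨅ t, LinearMap.ker (homEquation M N t) by rw [hr]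
  ext h
  simp only [LinearMap.mem_range, Submodule.mem_iInf, LinearMap.mem_ker]
  constructor
  · rintro ⟨f, rfl⟩ ⟨a, m, i⟩
    exact sub_eq_zero.2 (congrFun (map_smul f a ((repEquiv M).symm m)).symm i)
  · intro hh
    exact ⟨{ toFun := fun m => (repEquiv N).symm (h (repEquiv M m))
             map_add' := fun m m' => map_add h _ _
             map_smul' := fun a m => funext fun i => (sub_eq_zero.1 (hh (a, m, i))).symm }, rfl⟩

/-- `dim Hom(M, N)` is upper semicontinuous. -/
theorem isOpen_finrank_hom_le {F : X → ModVariety K A d} {G : X → ModVariety K A d'}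
    (hF : IsRegularFamily c F) (hG : IsRegularFamily c G) (m : ℕ) :
    IsOpen[zariskiTopology K c] {x | Module.finrank K (Rep (F x) →ₗ[A] Rep (G x)) ≤ m} := by
  simp only [finrank_hom_rep]
  refine isOpen_finrank_iInf_ker_le (fun t h => ?_) m
  exact sub_mem (hG.mulVec _ _ _)
    (form_mem_regularFunctions (hF.mulVec t.1 t.2.1) ((LinearMap.proj t.2.2).comp h))

/-- The linear equations for derivations `A → Hom_K(M, S)`. -/
def cocycleEquation (M : ModVariety K A d) (S : ModVariety K A d')
    (t : A × A × (Fin d → K) × Fin d') :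
    Module.Dual K (A →ₗ[K] (Fin d → K) →ₗ[K] (Fin d' → K)) where
  toFun δ := (S t.2.1).mulVec (δ t.1 t.2.2.1) t.2.2.2 +
    δ t.2.1 ((M t.1).mulVec t.2.2.1) t.2.2.2 - δ (t.2.1 * t.1) t.2.2.1 t.2.2.2
  map_add' h h' := by simp only [LinearMap.add_apply, Matrix.mulVec_add, Pi.add_apply]; ring
  map_smul' k h := by
    simp only [LinearMap.smul_apply, Matrix.mulVec_smul, Pi.smul_apply, smul_eq_mul,
      RingHom.id_apply]
    ring

theorem finrank_cocycles_rep (M : ModVariety K A d) (S : ModVariety K A d') :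
    Module.finrank K (cocycles K A (Rep M) (Rep S)) =
      Module.finrank K (⨅ t, LinearMap.ker (cocycleEquation M S t) :
        Submodule K (A →ₗ[K] (Fin d → K) →ₗ[K] (Fin d' → K))) := by
  let e : (A →ₗ[K] Rep M →ₗ[K] Rep S) ≃ₗ[K] (A →ₗ[K] (Fin d → K) →ₗ[K] (Fin d' → K)) :=
    LinearEquiv.congrRight (LinearEquiv.arrowCongr (repEquiv M) (repEquiv S))
  rw [← LinearEquiv.finrank_map_eq e]
  suffices hr : (cocycles K A (Rep M) (Rep S)).map (e : _ →ₗ[K] _) =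
      ⨅ t, LinearMap.ker (cocycleEquation M S t) by rw [hr]
  ext δ
  simp only [Submodule.mem_map, Submodule.mem_iInf, LinearMap.mem_ker]
  constructor
  · rintro ⟨δ, hδ, rfl⟩ ⟨a, b, m, i⟩
    exact sub_eq_zero.2 (congrFun (hδ a b ((repEquiv M).symm m)) i)
  · intro h
    refine ⟨e.symm δ, fun a b m => ?_, e.apply_symm_apply δ⟩
    exact funext fun i => sub_eq_zero.1 (h (a, b, m, i))

/-- The dimension of the space of derivations `A → Hom_K(M, S)` is upper semicontinuous. -/
theorem isOpen_finrank_cocycles_le [FiniteDimensional K A] {F : X → ModVariety K A d}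
    {G : X → ModVariety K A d'}
    (hF : IsRegularFamily c F) (hG : IsRegularFamily c G) (m : ℕ) :
    IsOpen[zariskiTopology K c] {x | Module.finrank K (cocycles K A (Rep (F x)) (Rep (G x))) ≤ m} := by
  have hV : FiniteDimensional K (A →ₗ[K] (Fin d → K) →ₗ[K] (Fin d' → K)) := inferInstance
  have key := isOpen_finrank_iInf_ker_le (c := c) (V := A →ₗ[K] (Fin d → K) →ₗ[K] (Fin d' → K))
    (L := fun x => cocycleEquation (F x) (G x)) (fun t δ => ?_) m
  · simpa only [finrank_cocycles_rep] using key
  obtain ⟨a, b, v, i⟩ := t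
  have h1 : (fun x => (G x b).mulVec (δ a v) i) ∈ regularFunctions c := hG.mulVec _ _ _
  have h2 : (fun x => δ b ((F x a).mulVec v) i) ∈ regularFunctions c :=
    form_mem_regularFunctions (hF.mulVec a v) ((LinearMap.proj i).comp (δ b))
  have h3 : (fun _ => δ (b * a) v i) ∈ regularFunctions c := const_mem_regularFunctions _
  exact sub_mem (add_mem h1 h2) h3

/-- `P` is isomorphic to a point of some module variety, which is then used as a constant family. -/
theorem isOpen_finrank_hom_fixed_le [FiniteDimensional K A] (P : Type*) [AddCommGroup P]
    [Module A P] [Module.Finite A P] {G : X → ModVariety K A d'} (hG : IsRegularFamily c G)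
    (m : ℕ) :
    IsOpen[zariskiTopology K c] {x | Module.finrank K (P →ₗ[A] Rep (G x)) ≤ m} := by
  let _ : Module K P := Module.compHom P (algebraMap K A)
  have : IsScalarTower K A P := IsScalarTower.of_algebraMap_smul fun _ _ => rfl
  have : FiniteDimensional K P := Module.Finite.trans A P
  obtain ⟨R, ⟨e⟩⟩ := exists_rep_linearEquiv (K := K) (A := A) P
  simp only [← finrank_hom_congr_left (K := K) e]
  exact isOpen_finrank_hom_le (isRegularFamily_const R) hG m

end Family

/-! ### Minimal presentations and the `E`-invariant -/

section Presentation

variable {K : Type u} [Field K] {A : Type v} [Ring A] [Algebra K A] [FiniteDimensional K A]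
  [IsArtinianRing A] {d d' : ℕ}

theorem E_add_finrank (M : ModVariety K A d) (N : ModVariety K A d') :
    E M N + Module.finrank K (P₀ A (Rep M) →ₗ[A] Rep N) =
      Module.finrank K (Rep M →ₗ[A] Rep N) + Module.finrank K (P₁ A (Rep M) →ₗ[A] Rep N) := by
  have h1 : Module.finrank K (LinearMap.range (precomp K (Rep N) (p₁ A (Rep M)))) +
      Module.finrank K (Rep N →ₗ[A] τ K A (Rep M)) =
      Module.finrank K (P₁ A (Rep M) →ₗ[A] Rep N) := finrank_hom_D_coker (p₁ A (Rep M))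
  have h2 := finrank_range_precomp (K := K) (N := Rep N) (p := p₁ A (Rep M))
    (projectiveCover A (Rep M)).surjective (by
      rw [p₁, LinearMap.range_comp, LinearMap.range_eq_top.2 (projectiveCover A _).surjective,
        Submodule.map_top, Submodule.range_subtype])
  have h3 : E M N = Module.finrank K (Rep N →ₗ[A] τ K A (Rep M)) := rfl
  rw [h3]
  omega

/-- Minimality enters here: for simple `S` the syzygy in `finrank_cocycles_add` can be replaced by
its projective cover `P₁`. -/
theorem finrank_cocycles_presentation (M : ModVariety K A d) (S : Type*) [AddCommGroup S]
    [Module K S] [Module A S] [IsScalarTower K A S] [FiniteDimensional K S] [IsSimpleModule A S] :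
    Module.finrank K (cocycles K A (Rep M) S) + Module.finrank K (P₀ A (Rep M) →ₗ[A] S) =
      Module.finrank K (P₁ A (Rep M) →ₗ[A] S) + d * Module.finrank K S := by
  let _ : Module K (P₀ A (Rep M)) := Module.compHom _ (algebraMap K A)
  have : IsScalarTower K A (P₀ A (Rep M)) := IsScalarTower.of_algebraMap_smul fun _ _ => rfl
  have : FiniteDimensional K (P₀ A (Rep M)) := Module.Finite.trans A _
  rw [finrank_cocycles_add (projectiveCover A (Rep M)).surjective, finrank_rep,
    finrank_hom_projectiveCover (projectiveCover A (Ω A (Rep M)))]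

/-- If `M` has no more derivations into the simple modules than `M₀`, then the minimal projective
presentations of `M` and `M₀` compare on all modules. -/
theorem finrank_presentation_le {M M₀ : ModVariety K A d}
    {l : List (Σ s : ℕ, ModVariety K A s)}
    (hl : ∀ (S : Type u) [AddCommGroup S] [Module A S] [IsSimpleModule A S] (f : A →ₗ[A] S),
      f ≠ 0 → ∃ t ∈ l, Nonempty (S ≃ₗ[A] Rep t.2))
    (h : ∀ t ∈ l, Module.finrank K (cocycles K A (Rep M) (Rep t.2)) ≤
      Module.finrank K (cocycles K A (Rep M₀) (Rep t.2))) (N : ModVariety K A d') :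
    Module.finrank K (P₁ A (Rep M) →ₗ[A] Rep N) + Module.finrank K (P₀ A (Rep M₀) →ₗ[A] Rep N) ≤
      Module.finrank K (P₁ A (Rep M₀) →ₗ[A] Rep N) +
        Module.finrank K (P₀ A (Rep M) →ₗ[A] Rep N) := by
  refine finrank_hom_le_of_simple (K := K) (fun S _ _ _ _ _ _ => ?_) (Rep N)
  have := IsSimpleModule.nontrivial A S
  obtain ⟨x, hx⟩ := exists_ne (0 : S)
  -- A simple module is a quotient of `A`, hence isomorphic to a member of the list.
  obtain ⟨t, ht, ⟨e⟩⟩ := hl S (LinearMap.toSpanSingleton A S x) fun h0 => hx (by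
    simpa using LinearMap.congr_fun h0 1)
  simp only [finrank_hom_congr_right (K := K) e]
  have := IsSimpleModule.congr e.symm
  have h1 := finrank_cocycles_presentation M (Rep t.2)
  have h2 := finrank_cocycles_presentation M₀ (Rep t.2)
  have h3 := h t ht
  omega

/-- The `E`-invariant is upper semicontinuous in regular families. -/
theorem isOpen_E_le {X : Type*} {σ : Type*} {c : X → σ → K} {F : X → ModVariety K A d}
    {G : X → ModVariety K A d'} (hF : IsRegularFamily c F) (hG : IsRegularFamily c G) (n : ℤ) :
    IsOpen[zariskiTopology K c] {x | E (F x) (G x) ≤ n} := by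
  let _ := zariskiTopology K c
  rw [isOpen_iff_forall_mem_open]
  intro x₀ hx₀
  obtain ⟨l, hl⟩ := exists_list_simple (K := K) (A := A) A
  obtain ⟨k, q, hq⟩ := Module.Finite.exists_fin' A (P₀ A (Rep (F x₀)))
  obtain ⟨s, hs⟩ := Module.projective_lifting_property q LinearMap.id hq
  have hs' : ∀ y, q (s y) = y := fun y => LinearMap.congr_fun hs y
  let e : (Fin k → A) ≃ₗ[A] P₀ A (Rep (F x₀)) × LinearMap.ker q :=
    LinearEquiv.ofLinearMap
      (q.prod ((LinearMap.id - s.comp q).codRestrict (LinearMap.ker q) fun y => by simp [hs']))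
      (s.coprod (LinearMap.ker q).subtype)
      (by
        refine LinearMap.ext fun y => Prod.ext ?_ (Subtype.ext ?_)
        · simp [hs']
        · simp [hs'])
      (by ext; simp)
  -- The complement `ker q` turns the negative term for `P₀` into a positive one: the two dimensions
  -- have constant sum, so an upper bound for one is a lower bound for the other.
  have hQ : ∀ x, Module.finrank K (P₀ A (Rep (F x₀)) →ₗ[A] Rep (G x)) +
      Module.finrank K (LinearMap.ker q →ₗ[A] Rep (G x)) = k * d' := by
    intro x
    rw [← finrank_hom_prod, ← finrank_hom_congr_left e, finrank_hom_fin, finrank_rep]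
  refine ⟨{x | Module.finrank K (Rep (F x) →ₗ[A] Rep (G x)) ≤
        Module.finrank K (Rep (F x₀) →ₗ[A] Rep (G x₀))} ∩
      {x | Module.finrank K (P₁ A (Rep (F x₀)) →ₗ[A] Rep (G x)) ≤
        Module.finrank K (P₁ A (Rep (F x₀)) →ₗ[A] Rep (G x₀))} ∩
      {x | Module.finrank K (LinearMap.ker q →ₗ[A] Rep (G x)) ≤
        Module.finrank K (LinearMap.ker q →ₗ[A] Rep (G x₀))} ∩
      ⋂ t ∈ {t | t ∈ l}, {x | Module.finrank K (cocycles K A (Rep (F x)) (Rep t.2)) ≤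
        Module.finrank K (cocycles K A (Rep (F x₀)) (Rep t.2))}, ?_, ?_, ?_⟩
  · rintro x ⟨⟨⟨h1, h2⟩, h3⟩, h4⟩
    simp only [Set.mem_iInter, Set.mem_ofPred_eq] at h1 h2 h3 h4 hx₀ ⊢
    -- Replaces the presentation of `F x` by that of `F x₀`; the other bounds then compare `G x`
    -- with `G x₀`.
    have h5 := finrank_presentation_le hl h4 (G x)
    have h6 := E_add_finrank (F x) (G x)
    have h7 := E_add_finrank (F x₀) (G x₀)
    have h8 := hQ x
    have h9 := hQ x₀
    omega
  · refine ((IsOpen.inter (isOpen_finrank_hom_le hF hG _)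
      (isOpen_finrank_hom_fixed_le _ hG _)).inter (isOpen_finrank_hom_fixed_le _ hG _)).inter ?_
    exact l.finite_toSet.isOpen_biInter fun t _ =>
      isOpen_finrank_cocycles_le hF (isRegularFamily_const t.2) _
  · simp

end Presentation

end ModVar

theorem corollary1p5 (K : Type u) [Field K] [IsAlgClosed K]
    (A : Type v) [Ring A] [Algebra K A] [FiniteDimensional K A] (d d' : ℕ) :
    (∀ n : ℤ, IsOpen[ModVar.pairTopology K A d d']
      {p : ModVar.ModVariety K A d × ModVar.ModVariety K A d' | ModVar.E p.1 p.2 ≤ n}) ∧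
    (∀ n : ℤ, IsOpen[ModVar.modTopology K A d]
      {M : ModVar.ModVariety K A d | ModVar.E M M ≤ n}) := by
  have : IsArtinianRing A := IsArtinianRing.of_finite K A
  -- Both claims are instances over different bases: the two projections on the product variety, and
  -- the identity taken twice on `mod(A,d)`.
  refine ⟨fun n => ModVar.isOpen_E_le (F := Prod.fst) (G := Prod.snd) ?_ ?_ n,
    fun n => ModVar.isOpen_E_le (F := id) (G := id) ?_ ?_ n⟩
  · exact fun a i j => ModVar.coord_mem_regularFunctions (Sum.inl (a, i, j))
  · exact fun a i j => ModVar.coord_mem_regularFunctions (Sum.inr (a, i, j))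
  · exact fun a i j => ModVar.coord_mem_regularFunctions (a, i, j)
  · exact fun a i j => ModVar.coord_mem_regularFunctions (a, i, j)
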